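/- **Setting.** Fix a finite label set $\Lambda$ with an arity function. Graphs are finite $\Lambda$-hypergraphs: each edge $e$ carries a label and a sequence of nodes whose length is the arity of the label, and $e$ is incident to the nodes of its sequence. Morphisms $\phi : G \rightharpoonup H$ are partial: they preserve labels and node sequences, and whenever they are defined on an edge they are defined on all its incident nodes. Pushouts are taken in the category of graphs and partial morphisms. A *subgraph morphism* is a partial, injective and surjective morphism, and $G_1 \sqsubseteq G_2$ means that there is a subgraph morphism from $G_2$ to $G_1$. A *universally quantified rule* $\rho=(r,U)$ consists of a partial morphism $r : L \rightharpoonup R$ and a finite set $U$ of pairs $u=(p_u,q_u)$, where $p_u : L \to L_u$ is total and injective and $q_u : L_u \rightharpoonup R_u$ is such that for every node or edge $x$ of $L$, $q_u(p_u(x))$ is defined and has exactly one preimage in $L_u$. The *quantified nodes* of $u$ are the nodes $v$ of $L$ such that $p_u(v)$ is incident to an edge of $L_u$ without preimage in $L$; each $u$ is required to have at least one. *Instantiations* of $\rho$ are defined recursively. The pair $(\mathrm{id}_L, r)$ is an instantiation of length $0$. If $(\pi : L\to \overline L,\ \gamma : \overline L \rightharpoonup \overline R)$ is an instantiation of length $n$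 and $u\in U$, let $\overline L_u$, with $p_u' : \overline L\to\overline L_u$, be the pushout of $\pi$ and $p_u$; let $\overline R_u$ be the pushout of $\gamma\circ\pi$ and $q_u\circ p_u$; and let $\eta:\overline L_u\rightharpoonup\overline R_u$ be the mediating morphism. Then $(\pi,\gamma)\diamond u := (p'_u\circ\pi,\ \eta)$ is an instantiation of length $n+1$. The pushout also provides a morphism $\overline R \to \overline R_u$, and "preimage in $\overline R$" refers to it. *Backward application.* Let $k\in\mathbb N\cup\{\infty\}$. A graph $H$ is *computed from $G$ by an instantiation $(\pi,\gamma)$* of $\rho$ (with path bound $k$) if there are a subgraph morphism $\mu : \overline R\rightharpoonup R'$, a total injective morphism $m' : R' \to G$ and a total injective morphism $m : \overline L\to H$ such that the following hold. 1. $(H,m)$ is a pushout complement of $\mu\circ\gamma$ and $m'$, and it is minimal among the pushout complements with injective match. Here $(H_1,m_1)$ is below $(H_2,m_2)$ if there is a subgraph morphism $\nu : H_2 \rightharpoonup H_1$ with $\nu\circ m_2=m_1$. 2. Every undirected path of $H$ (an alternating sequence of consecutively incident nodes and edges in which no node and no edge is repeated) has at most $k$ edges. 3. For every $x\in V_L$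 that is a quantified node of some $u\in U$, every edge of $H$ incident to $m(\pi(x))$ has a preimage under $m$. A number $N$ is an *instantiation bound* for $\rho$ and $G$ if, for every graph $H$ computed from $G$ by an instantiation of $\rho$ of any length, there is a graph $H'\sqsubseteq H$ that is computed from $G$ by an instantiation of $\rho$ of length at most $N$. **Lemma.** Let $\rho=(r : L\rightharpoonup R,\,U)$ be a universally quantified rule and, for $u\in U$, let $(\mathrm{id}_L,r)\diamond u=(\pi : L\to\overline L_u,\ \gamma : \overline L_u\rightharpoonup\overline R_u)$. Suppose that for every $u\in U$, every edge $e$ of $\overline R_u$ without preimage in $R$ is incident to a node of $\overline R_u$ without preimage in $R$. Then for every graph $G$ and every $k\in\mathbb N\cup\{\infty\}$, the number $|V_G|$ of nodes of $G$ is an instantiation bound for $\rho$ and $G$ (with path bound $k$). -/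

import Mathlib

open CategoryTheory

namespace UGTS

universe v u

/-- A finite hypergraph over the label alphabet `Λ` with arity function `ar`. -/
structure HGraph {Λ : Type v} (ar : Λ → ℕ) where
  V : Type u
  E : Type u
  finV : Finite V
  finE : Finite E
  /-- connection function -/
  conn : E → List V
  /-- labelling function -/
  lab : E → Λ
  conn_length : ∀ e, (conn e).length = ar (lab e)

/-- Partial hypergraph morphisms; `none` is "undefined". If the morphism is defined on an edge, then
the label is kept, the morphism is defined on all incident nodes, and it maps the sequence of nodes
of the edge to the sequence of nodes of its image. -/
@[ext]
structure PMor {Λ : Type v} {ar : Λ → ℕ} (G H : HGraph.{v, u} ar) where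
  onV : G.V → Option H.V
  onE : G.E → Option H.E
  lab_eq : ∀ e e', onE e = some e' → G.lab e = H.lab e'
  conn_eq : ∀ e e', onE e = some e' → (G.conn e).map onV = (H.conn e').map some

variable {Λ : Type v} {ar : Λ → ℕ}

/-- The identity morphism. -/
def PMor.id (G : HGraph.{v, u} ar) : PMor G G where
  onV := some
  onE := some
  lab_eq := by
    intro e e' h
    cases h
    rfl
  conn_eq := by
    intro e e' h
    cases h
    rfl

/-- Composition of partial morphisms (first `f`, then `g`), defined where both are. -/
def PMor.comp {G H K : HGraph.{v, u} ar} (f : PMor G H) (g : PMor H K) : PMor G K where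
  onV x := (f.onV x).bind g.onV
  onE e := (f.onE e).bind g.onE
  lab_eq := by
    intro e e' h
    obtain ⟨d, hd, hd'⟩ := Option.bind_eq_some_iff.1 h
    exact (f.lab_eq e d hd).trans (g.lab_eq d e' hd')
  conn_eq := by
    intro e e' h
    obtain ⟨d, hd, hd'⟩ := Option.bind_eq_some_iff.1 h
    have h1 := congrArg (List.map (fun o : Option H.V => o.bind g.onV)) (f.conn_eq e d hd)
    have h2 := g.conn_eq d e' hd'
    simp only [List.map_map] at h1
    rw [← h2]
    exact h1

/-- The category of hypergraphs and partial morphisms. -/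
instance : Category (HGraph.{v, u} ar) where
  Hom := PMor
  id := PMor.id
  comp := PMor.comp
  id_comp := by
    intro G H f
    rfl
  comp_id := by
    intro G H f
    apply PMor.ext
    · funext x
      exact Option.bind_fun_some (f.onV x)
    · funext x
      exact Option.bind_fun_some (f.onE x)
  assoc := by
    intro G H K M f g h
    apply PMor.ext
    · funext x
      exact Option.bind_assoc (f.onV x) g.onV h.onV
    · funext x
      exact Option.bind_assoc (f.onE x) g.onE h.onE

/-- The node part of a morphism. -/
def nodeMap {G H : HGraph.{v, u} ar} (f : G ⟶ H) : G.V → Option H.V := PMor.onV f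

/-- The edge part of a morphism. -/
def edgeMap {G H : HGraph.{v, u} ar} (f : G ⟶ H) : G.E → Option H.E := PMor.onE f

/-- The edge `e` is incident to the node `x`. -/
def Incident (G : HGraph.{v, u} ar) (e : G.E) (x : G.V) : Prop := x ∈ G.conn e

/-- Total morphisms. -/
def IsTotal {G H : HGraph.{v, u} ar} (f : G ⟶ H) : Prop :=
  (∀ x, ∃ y, nodeMap f x = some y) ∧ (∀ e, ∃ d, edgeMap f e = some d)

/-- Injectivity of a partial morphism, on its domain of definition. -/
def IsInj {G H : HGraph.{v, u} ar} (f : G ⟶ H) : Prop :=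
  (∀ x x' y, nodeMap f x = some y → nodeMap f x' = some y → x = x') ∧
  (∀ e e' d, edgeMap f e = some d → edgeMap f e' = some d → e = e')

/-- Surjectivity of a partial morphism. -/
def IsSurj {G H : HGraph.{v, u} ar} (f : G ⟶ H) : Prop :=
  (∀ y, ∃ x, nodeMap f x = some y) ∧ (∀ d, ∃ e, edgeMap f e = some d)

/-- Subgraph morphisms: partial, injective and surjective. -/
def IsSubgraphMor {G H : HGraph.{v, u} ar} (f : G ⟶ H) : Prop := IsInj f ∧ IsSurj f

/-- `SubOrder G₁ G₂`: the graph `G₁` is (isomorphic to) a subgraph of `G₂`. -/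
def SubOrder (G₁ G₂ : HGraph.{v, u} ar) : Prop := ∃ μ : G₂ ⟶ G₁, IsSubgraphMor μ

/-- Every undirected path (no node and no edge occurs twice) of `G` has length at most `k`.
For `k = ⊤` this is no restriction. -/
def PathBounded (k : ℕ∞) (G : HGraph.{v, u} ar) : Prop :=
  ∀ (n : ℕ) (x : Fin (n + 1) → G.V) (e : Fin n → G.E),
    Function.Injective x → Function.Injective e →
    (∀ i : Fin n, Incident G (e i) (x i.castSucc) ∧ Incident G (e i) (x i.succ)) →
    (n : ℕ∞) ≤ k

/-- A universal quantification `(p, q)` over the left-hand side `L`. -/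
structure UnivQuant (L : HGraph.{v, u} ar) where
  Lu : HGraph.{v, u} ar
  Ru : HGraph.{v, u} ar
  p : L ⟶ Lu
  q : Lu ⟶ Ru
  p_total : IsTotal p
  p_inj : IsInj p
  /-- `q (p x)` is defined and has exactly one preimage in `Lu`, for all nodes `x` of `L` -/
  q_node : ∀ x y, nodeMap p x = some y →
    ∃ z, nodeMap q y = some z ∧ ∀ y', nodeMap q y' = some z → y' = y
  /-- `q (p x)` is defined and has exactly one preimage in `Lu`, for all edges `x` of `L` -/
  q_edge : ∀ x y, edgeMap p x = some y →
    ∃ z, edgeMap q y = some z ∧ ∀ y', edgeMap q y' = some z → y' = y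
  /-- there is at least one quantified node: a node `x` of `L` such that some edge of `Lu` without
  preimage in `L` is incident to `p x` -/
  exists_quantified : ∃ (x : L.V) (y : Lu.V) (e : Lu.E),
    nodeMap p x = some y ∧ Incident Lu e y ∧ ∀ d, edgeMap p d ≠ some e

/-- The quantified nodes of a universal quantification. -/
def UnivQuant.qNodes {L : HGraph.{v, u} ar} (w : UnivQuant L) : Set L.V :=
  {x | ∃ (y : w.Lu.V) (e : w.Lu.E),
    nodeMap w.p x = some y ∧ Incident w.Lu e y ∧ ∀ d, edgeMap w.p d ≠ some e}

/-- Universally quantified rules `(r : L ⇀ R, U)`. -/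
structure UQRule {Λ : Type v} (ar : Λ → ℕ) where
  L : HGraph.{v, u} ar
  R : HGraph.{v, u} ar
  r : L ⟶ R
  U : Set (UnivQuant L)
  U_finite : U.Finite

/-- The quantified nodes of a rule. -/
def UQRule.qNodes (ρ : UQRule.{v, u} ar) : Set ρ.L.V := {x | ∃ w ∈ ρ.U, x ∈ w.qNodes}

/-- The pair `(π ≫ p', η)` extends the pair `(π : L ⟶ L₁, γ : L₁ ⟶ R₁)` by one use of the
quantification `w`: `L₂` is the pushout of `π` and `w.p`, `R₂` is the pushout of `γ ∘ π` and
`w.q ∘ w.p`, and `η` is the mediating morphism. The morphisms `p' : L₁ ⟶ L₂` and `i : R₁ ⟶ R₂`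
are the pushout morphisms from the old left and right side into the new ones. -/
def IsInstStep {L L₁ R₁ L₂ R₂ : HGraph.{v, u} ar} (π : L ⟶ L₁) (γ : L₁ ⟶ R₁) (w : UnivQuant L)
    (p' : L₁ ⟶ L₂) (i : R₁ ⟶ R₂) (η : L₂ ⟶ R₂) : Prop :=
  ∃ (π' : w.Lu ⟶ L₂) (j : w.Ru ⟶ R₂),
    IsPushout π w.p p' π' ∧ IsPushout (π ≫ γ) (w.p ≫ w.q) i j ∧
    p' ≫ η = γ ≫ i ∧ π' ≫ η = w.q ≫ j

/-- `IsInst ρ n π γ`: the pair `(π, γ)` is an instantiation of `ρ` of length `n`. -/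
inductive IsInst (ρ : UQRule.{v, u} ar) :
    ℕ → ∀ {L₁ R₁ : HGraph.{v, u} ar}, (ρ.L ⟶ L₁) → (L₁ ⟶ R₁) → Prop
  | base : IsInst ρ 0 (𝟙 ρ.L) ρ.r
  | step {n : ℕ} {L₁ R₁ L₂ R₂ : HGraph.{v, u} ar} {π : ρ.L ⟶ L₁} {γ : L₁ ⟶ R₁}
      {p' : L₁ ⟶ L₂} {i : R₁ ⟶ R₂} {η : L₂ ⟶ R₂} (w : UnivQuant ρ.L) :
      IsInst ρ n π γ → w ∈ ρ.U → IsInstStep π γ w p' i η → IsInst ρ (n + 1) (π ≫ p') η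

/-- `(H, m)` is a pushout complement of `f : L₁ ⇀ R'` and `g : R' ⟶ G` such that `m : L₁ ⟶ H` is
total and injective. -/
def IsPOC {L₁ R' G H : HGraph.{v, u} ar} (f : L₁ ⟶ R') (g : R' ⟶ G) (m : L₁ ⟶ H) : Prop :=
  IsTotal m ∧ IsInj m ∧ ∃ ψ : H ⟶ G, IsPushout f m g ψ

/-- The subgraph ordering on objects under `L₁`: `(H, m)` is below `(H', m')` if there is a subgraph
morphism from `H'` to `H` that commutes with the morphisms `m'`, `m` from `L₁`. -/
def MatchLE {L₁ H H' : HGraph.{v, u} ar} (m : L₁ ⟶ H) (m' : L₁ ⟶ H') : Prop :=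
  ∃ μ : H' ⟶ H, IsSubgraphMor μ ∧ m' ≫ μ = m

/-- Minimal pushout complements, among those with a total and injective `m`. -/
def IsMinPOC {L₁ R' G H : HGraph.{v, u} ar} (f : L₁ ⟶ R') (g : R' ⟶ G) (m : L₁ ⟶ H) : Prop :=
  IsPOC f g m ∧
    ∀ (H' : HGraph.{v, u} ar) (m' : L₁ ⟶ H'), IsPOC f g m' → MatchLE m' m → MatchLE m m'

/-- The application condition for a match `m : L₁ ⟶ H` of an instantiation `(π, γ)`: every edge of
`H` that is incident to the image of a quantified node of the rule has a preimage under `m`. -/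
def AppCond (ρ : UQRule.{v, u} ar) {L₁ H : HGraph.{v, u} ar} (π : ρ.L ⟶ L₁) (m : L₁ ⟶ H) : Prop :=
  ∀ x ∈ ρ.qNodes, ∀ y, nodeMap (π ≫ m) x = some y →
    ∀ e, Incident H e y → ∃ d, edgeMap m d = some e

/-- The graphs that the backward step computes from `G` by the backward application of
instantiations of `ρ` of length `n`, restricted to the graphs whose undirected paths have length at
most `k` (`k = ⊤`: no restriction): compose an instantiation with a subgraph morphism `μ`, take a
total injective co-match `g` into `G`, and take the minimal pushout complements (with an injective
match) that satisfy the path bound and the application condition. -/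
def backward (ρ : UQRule.{v, u} ar) (k : ℕ∞) (n : ℕ) (G : HGraph.{v, u} ar) :
    Set (HGraph.{v, u} ar) :=
  {H | ∃ (L₁ R₁ : HGraph.{v, u} ar) (π : ρ.L ⟶ L₁) (γ : L₁ ⟶ R₁), IsInst ρ n π γ ∧
    ∃ (R' : HGraph.{v, u} ar) (μ : R₁ ⟶ R') (g : R' ⟶ G) (m : L₁ ⟶ H),
      IsSubgraphMor μ ∧ IsTotal g ∧ IsInj g ∧ IsMinPOC (γ ≫ μ) g m ∧
      PathBounded k H ∧ AppCond ρ π m}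

/-- `N` is an upper bound on the length of the instantiations of `ρ` that are necessary to compute
the backward step from `G`: every graph computed from an instantiation of any length is represented
by (has as a subgraph) a graph computed from an instantiation of length at most `N`. -/
def IsInstBound (ρ : UQRule.{v, u} ar) (k : ℕ∞) (G : HGraph.{v, u} ar) (N : ℕ) : Prop :=
  ∀ n, ∀ H ∈ backward ρ k n G, ∃ n' ≤ N, ∃ H' ∈ backward ρ k n' G, SubOrder H' H

/-- For every quantification `w` of `ρ`, every edge that the step from `(𝟙, r)` by `w` newly adds to
the right side is incident to a node that this step newly adds to the right side. -/
def NewEdgesAtNewNodes (ρ : UQRule.{v, u} ar) : Prop :=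
  ∀ w ∈ ρ.U, ∀ (L₂ R₂ : HGraph.{v, u} ar) (p' : ρ.L ⟶ L₂) (i : ρ.R ⟶ R₂) (η : L₂ ⟶ R₂),
    IsInstStep (𝟙 ρ.L) ρ.r w p' i η →
    ∀ e : R₂.E, (∀ d, edgeMap i d ≠ some e) →
      ∃ y : R₂.V, Incident R₂ e y ∧ ∀ x, nodeMap i x ≠ some y

end UGTS

namespace UGTS

universe v u

/-! ### Partial morphisms: composition, inverses of injective morphisms, isomorphisms -/

section Basic

variable {Λ : Type v} {ar : Λ → ℕ} {G H K : HGraph.{v, u} ar}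

/-! Suppose `H` is computed by an instantiation of length `n > |V_G|`. Number the steps `0, …, n -
1` and give each node of the right side the number of the step that created it. The subgraph
morphism `μ` followed by the injective co-match embeds the nodes surviving `μ` into `V_G`, so by
pigeonhole there is a step `s` none of whose nodes survives. Its new edges do not survive either: by
hypothesis each of them has a new node, and a partial morphism defined on an edge is defined on its
nodes. Hence step `s` can be left out, and strong induction on `n` finishes the proof
(`exists_shorter`, `isInstBound_card`).

Two points need work. First, leaving out step `s` must give an instantiation again, related to the
old one by subgraph morphisms `c` and `d` on the left and right sides. For the last step these are
retractions of the pushouts (`hasReduction_last`). For an earlier step, the later steps are repeated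
on the shorter instantiation, and `c`, `d` are pushed out along them (`HasReduction.step`). Both
rest on an explicit pushout along a total injective morphism (`isPushout_glue`), and on pasting,
which exhibits every step on the right as a pushout of the first step from `r`, so that the
hypothesis on first steps applies to all of them.

Second, the backward step must descend to the shorter instantiation. Pushing the match out along `c`
and cancelling this square from the given pushout makes the result a pushout complement for the
shorter instantiation. It is a subgraph of `H`, and so is a minimal complement below it; the path
bound and the application condition pass to such subgraphs (`exists_mem_backward_of_factors`). -/

@[simp] theorem nodeMap_comp (f : G ⟶ H) (g : H ⟶ K) (x : G.V) :
    nodeMap (f ≫ g) x = (nodeMap f x).bind (nodeMap g) := rfl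

@[simp] theorem edgeMap_comp (f : G ⟶ H) (g : H ⟶ K) (x : G.E) :
    edgeMap (f ≫ g) x = (edgeMap f x).bind (edgeMap g) := rfl

@[simp] theorem nodeMap_id (x : G.V) : nodeMap (𝟙 G) x = some x := rfl

@[simp] theorem edgeMap_id (x : G.E) : edgeMap (𝟙 G) x = some x := rfl

theorem hom_ext {f g : G ⟶ H} (hV : ∀ x, nodeMap f x = nodeMap g x)
    (hE : ∀ e, edgeMap f e = edgeMap g e) : f = g :=
  PMor.ext (funext hV) (funext hE)

theorem exists_incident_image (f : G ⟶ H) {e : G.E} {e' : H.E} (h : edgeMap f e = some e')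
    {x : G.V} (hx : Incident G e x) : ∃ x', nodeMap f x = some x' ∧ Incident H e' x' := by
  have h1 : nodeMap f x ∈ (G.conn e).map (nodeMap f) := List.mem_map_of_mem hx
  rw [show (G.conn e).map (nodeMap f) = (H.conn e').map some from f.conn_eq e e' h] at h1
  obtain ⟨x', hx', h2⟩ := List.mem_map.1 h1
  exact ⟨x', h2.symm, hx'⟩

theorem exists_incident_preimage (f : G ⟶ H) {e : G.E} {e' : H.E} (h : edgeMap f e = some e')
    {x' : H.V} (hx : Incident H e' x') : ∃ x, nodeMap f x = some x' ∧ Incident G e x := by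
  have h1 : some x' ∈ (H.conn e').map some := List.mem_map_of_mem hx
  rw [← show (G.conn e).map (nodeMap f) = (H.conn e').map some from f.conn_eq e e' h] at h1
  obtain ⟨x, hx, h2⟩ := List.mem_map.1 h1
  exact ⟨x, h2, hx⟩

theorem IsTotal.comp {f : G ⟶ H} {g : H ⟶ K} (hf : IsTotal f) (hg : IsTotal g) :
    IsTotal (f ≫ g) := by
  constructor
  · intro x
    obtain ⟨y, hy⟩ := hf.1 x
    simpa [hy] using hg.1 y
  · intro x
    obtain ⟨y, hy⟩ := hf.2 x
    simpa [hy] using hg.2 y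

theorem IsInj.comp {f : G ⟶ H} {g : H ⟶ K} (hf : IsInj f) (hg : IsInj g) : IsInj (f ≫ g) := by
  constructor
  · intro x x' z h h'
    obtain ⟨y, hy, hz⟩ := Option.bind_eq_some_iff.1 h
    obtain ⟨y', hy', hz'⟩ := Option.bind_eq_some_iff.1 h'
    obtain rfl := hg.1 _ _ _ hz hz'
    exact hf.1 _ _ _ hy hy'
  · intro x x' z h h'
    obtain ⟨y, hy, hz⟩ := Option.bind_eq_some_iff.1 h
    obtain ⟨y', hy', hz'⟩ := Option.bind_eq_some_iff.1 h'
    obtain rfl := hg.2 _ _ _ hz hz'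
    exact hf.2 _ _ _ hy hy'

theorem IsSurj.comp {f : G ⟶ H} {g : H ⟶ K} (hf : IsSurj f) (hg : IsSurj g) :
    IsSurj (f ≫ g) := by
  constructor
  · intro z
    obtain ⟨y, hy⟩ := hg.1 z
    obtain ⟨x, hx⟩ := hf.1 y
    exact ⟨x, by simp [hx, hy]⟩
  · intro z
    obtain ⟨y, hy⟩ := hg.2 z
    obtain ⟨x, hx⟩ := hf.2 y
    exact ⟨x, by simp [hx, hy]⟩

theorem IsSurj.of_comp {f : G ⟶ H} {g : H ⟶ K} (h : IsSurj (f ≫ g)) : IsSurj g := by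
  constructor
  · intro z
    obtain ⟨x, hx⟩ := h.1 z
    obtain ⟨y, -, hy⟩ := Option.bind_eq_some_iff.1 hx
    exact ⟨y, hy⟩
  · intro z
    obtain ⟨x, hx⟩ := h.2 z
    obtain ⟨y, -, hy⟩ := Option.bind_eq_some_iff.1 hx
    exact ⟨y, hy⟩

theorem IsTotal.id (G : HGraph.{v, u} ar) : IsTotal (𝟙 G) := ⟨fun x => ⟨x, rfl⟩, fun x => ⟨x, rfl⟩⟩

theorem IsSubgraphMor.id (G : HGraph.{v, u} ar) : IsSubgraphMor (𝟙 G) := by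
  refine ⟨⟨?_, ?_⟩, fun x => ⟨x, rfl⟩, fun x => ⟨x, rfl⟩⟩ <;>
  · intro x x' y h h'
    cases h
    cases h'
    rfl

theorem IsSubgraphMor.comp {f : G ⟶ H} {g : H ⟶ K} (hf : IsSubgraphMor f)
    (hg : IsSubgraphMor g) : IsSubgraphMor (f ≫ g) :=
  ⟨hf.1.comp hg.1, hf.2.comp hg.2⟩

/-- The inverse of a partial function that is injective on its domain. -/
noncomputable def partialInv {α β : Type*} (f : α → Option β) (y : β) : Option α :=
  open Classical in if h : ∃ x, f x = some y then some h.choose else none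

theorem partialInv_eq_some {α β : Type*} {f : α → Option β}
    (hf : ∀ x x' y, f x = some y → f x' = some y → x = x') {x : α} {y : β} :
    partialInv f y = some x ↔ f x = some y := by
  unfold partialInv
  split_ifs with h
  · rw [Option.some_inj]
    constructor
    · rintro rfl
      exact h.choose_spec
    · exact hf _ _ _ h.choose_spec
  · simp only [false_iff]
    exact fun h' => h ⟨x, h'⟩

/-- The inverse of an injective partial morphism. -/
noncomputable def invMor (f : G ⟶ H) (hf : IsInj f) : H ⟶ G where
  onV := partialInv (nodeMap f)
  onE := partialInv (edgeMap f)
  lab_eq e e' h := (f.lab_eq e' e ((partialInv_eq_some hf.2).1 h)).symm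
  conn_eq e e' h := by
    have h1 : (G.conn e').map (nodeMap f) = (H.conn e).map some :=
      f.conn_eq e' e ((partialInv_eq_some hf.2).1 h)
    have h2 := congrArg (List.map (fun o : Option H.V => o.bind (partialInv (nodeMap f)))) h1
    simp only [List.map_map] at h2
    refine Eq.trans h2.symm (List.map_congr_left fun x hx => ?_)
    obtain ⟨y, hy, -⟩ := exists_incident_image f ((partialInv_eq_some hf.2).1 h) hx
    simp only [Function.comp_apply, hy, Option.bind_some]
    exact (partialInv_eq_some hf.1).2 hy

theorem nodeMap_invMor {f : G ⟶ H} (hf : IsInj f) {x : G.V} {y : H.V} :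
    nodeMap (invMor f hf) y = some x ↔ nodeMap f x = some y :=
  partialInv_eq_some hf.1

theorem edgeMap_invMor {f : G ⟶ H} (hf : IsInj f) {x : G.E} {y : H.E} :
    edgeMap (invMor f hf) y = some x ↔ edgeMap f x = some y :=
  partialInv_eq_some hf.2

theorem IsInj.invMor {f : G ⟶ H} (hf : IsInj f) : IsInj (invMor f hf) := by
  constructor
  · intro x x' y h h'
    rw [nodeMap_invMor] at h h'
    exact Option.some_inj.1 (h.symm.trans h')
  · intro x x' y h h'
    rw [edgeMap_invMor] at h h'
    exact Option.some_inj.1 (h.symm.trans h')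

theorem IsSurj.invMor {f : G ⟶ H} (hf : IsInj f) (ht : IsTotal f) : IsSurj (invMor f hf) := by
  constructor
  · intro x
    obtain ⟨y, hy⟩ := ht.1 x
    exact ⟨y, (nodeMap_invMor hf).2 hy⟩
  · intro x
    obtain ⟨y, hy⟩ := ht.2 x
    exact ⟨y, (edgeMap_invMor hf).2 hy⟩

theorem comp_invMor {f : G ⟶ H} (hf : IsInj f) (ht : IsTotal f) : f ≫ invMor f hf = 𝟙 G := by
  apply hom_ext
  · intro x
    obtain ⟨y, hy⟩ := ht.1 x
    simpa [hy] using (nodeMap_invMor hf).2 hy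
  · intro x
    obtain ⟨y, hy⟩ := ht.2 x
    simpa [hy] using (edgeMap_invMor hf).2 hy

theorem IsTotal.of_iso (φ : G ≅ H) : IsTotal φ.hom := by
  constructor
  · intro x
    have h : nodeMap (φ.hom ≫ φ.inv) x = some x := by rw [φ.hom_inv_id]; rfl
    obtain ⟨y, hy, -⟩ := Option.bind_eq_some_iff.1 h
    exact ⟨y, hy⟩
  · intro x
    have h : edgeMap (φ.hom ≫ φ.inv) x = some x := by rw [φ.hom_inv_id]; rfl
    obtain ⟨y, hy, -⟩ := Option.bind_eq_some_iff.1 h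
    exact ⟨y, hy⟩

theorem IsSubgraphMor.of_iso (φ : G ≅ H) : IsSubgraphMor φ.hom := by
  refine ⟨⟨?_, ?_⟩, IsSurj.of_comp (f := φ.inv) (by rw [φ.inv_hom_id]; exact (IsSubgraphMor.id H).2)⟩
  · intro x x' y h h'
    have h1 : nodeMap (φ.hom ≫ φ.inv) x = some x := by rw [φ.hom_inv_id]; rfl
    have h2 : nodeMap (φ.hom ≫ φ.inv) x' = some x' := by rw [φ.hom_inv_id]; rfl
    rw [nodeMap_comp, h, ← h', ← nodeMap_comp, h2] at h1
    exact (Option.some_inj.1 h1).symm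
  · intro x x' y h h'
    have h1 : edgeMap (φ.hom ≫ φ.inv) x = some x := by rw [φ.hom_inv_id]; rfl
    have h2 : edgeMap (φ.hom ≫ φ.inv) x' = some x' := by rw [φ.hom_inv_id]; rfl
    rw [edgeMap_comp, h, ← h', ← edgeMap_comp, h2] at h1
    exact (Option.some_inj.1 h1).symm

end Basic

/-! ### Gluing sets along a partial function and a total injection -/

section Glue

/-- Elementwise description of the gluing of two sets along partial functions `f` and `k`, where `k`
is total and injective: the result consists of a copy of `A` and of the part of `B` outside the
range of `k` on which `j` is defined. -/
structure PGlue {L A B P : Type*} (f : L → Option A) (k : L → Option B) (i : A → Option P)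
    (j : B → Option P) : Prop where
  comm : ∀ x, (f x).bind i = (k x).bind j
  total : ∀ a, ∃ y, i a = some y
  inj : ∀ a a' y, i a = some y → i a' = some y → a = a'
  cover : ∀ y, (∃ a, i a = some y) ∨ ∃ b, j b = some y ∧ ∀ x, k x ≠ some b
  disj : ∀ b y, j b = some y → (∀ x, k x ≠ some b) → ∀ a, i a ≠ some y
  inj_right : ∀ b b' y, j b = some y → j b' = some y → (∀ x, k x ≠ some b) →
    (∀ x, k x ≠ some b') → b = b'

namespace PGlue

variable {L A B P : Type*} {f : L → Option A} {k : L → Option B} {i : A → Option P}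
  {j : B → Option P}

/-- Transports the description from the explicit gluing to an arbitrary pushout, along the
comparison isomorphism. -/
theorem comp_right {Q : Type*} (h : PGlue f k i j) {φ : P → Option Q}
    (ht : ∀ x, ∃ y, φ x = some y) (hi : ∀ x x' y, φ x = some y → φ x' = some y → x = x')
    (hs : ∀ y, ∃ x, φ x = some y) :
    PGlue f k (fun a => (i a).bind φ) (fun b => (j b).bind φ) where
  comm x := by
    have := congrArg (fun o => Option.bind o φ) (h.comm x)
    simpa only [Option.bind_assoc] using this
  total a := by
    obtain ⟨y, hy⟩ := h.total a
    simpa [hy] using ht y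
  inj a a' z ha ha' := by
    obtain ⟨y, hy, hz⟩ := Option.bind_eq_some_iff.1 ha
    obtain ⟨y', hy', hz'⟩ := Option.bind_eq_some_iff.1 ha'
    obtain rfl := hi _ _ _ hz hz'
    exact h.inj _ _ _ hy hy'
  cover z := by
    obtain ⟨y, hy⟩ := hs z
    rcases h.cover y with ⟨a, ha⟩ | ⟨b, hb, hk⟩
    · exact Or.inl ⟨a, by simp [ha, hy]⟩
    · exact Or.inr ⟨b, by simp [hb, hy], hk⟩
  disj b z hb hk a ha := by
    obtain ⟨y, hy, hz⟩ := Option.bind_eq_some_iff.1 hb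
    obtain ⟨y', hy', hz'⟩ := Option.bind_eq_some_iff.1 ha
    obtain rfl := hi _ _ _ hz hz'
    exact h.disj _ _ hy hk a hy'
  inj_right b b' z hb hb' hk hk' := by
    obtain ⟨y, hy, hz⟩ := Option.bind_eq_some_iff.1 hb
    obtain ⟨y', hy', hz'⟩ := Option.bind_eq_some_iff.1 hb'
    obtain rfl := hi _ _ _ hz hz'
    exact h.inj_right _ _ _ hy hy' hk hk'

theorem right_surj (h : PGlue f k i j) (hk : ∀ x, ∃ y, k x = some y)
    (hf : ∀ y, ∃ x, f x = some y) (y : P) : ∃ b, j b = some y := by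
  rcases h.cover y with ⟨a, ha⟩ | ⟨b, hb, -⟩
  · obtain ⟨x, hx⟩ := hf a
    obtain ⟨b, hb⟩ := hk x
    have := h.comm x
    rw [hx, hb, Option.bind_some, Option.bind_some, ha] at this
    exact ⟨b, this.symm⟩
  · exact ⟨b, hb⟩

theorem right_eq_of_mem (h : PGlue f k i j) {x : L} {b : B} (hx : k x = some b) :
    j b = (f x).bind i := by
  rw [h.comm, hx, Option.bind_some]

/-- Elements in the range of `k` are separated by `f` and `i`, those outside it by `inj_right`, and
`disj` excludes the mixed cases. -/
theorem right_inj (h : PGlue f k i j) (hf : ∀ x x' y, f x = some y → f x' = some y → x = x')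
    (b b' : B) (y : P) (hb : j b = some y) (hb' : j b' = some y) : b = b' := by
  by_cases hx : ∃ x, k x = some b <;> by_cases hx' : ∃ x, k x = some b'
  · obtain ⟨x, hx⟩ := hx
    obtain ⟨x', hx'⟩ := hx'
    rw [h.right_eq_of_mem hx] at hb
    rw [h.right_eq_of_mem hx'] at hb'
    obtain ⟨a, ha, hy⟩ := Option.bind_eq_some_iff.1 hb
    obtain ⟨a', ha', hy'⟩ := Option.bind_eq_some_iff.1 hb'
    obtain rfl := h.inj _ _ _ hy hy'
    obtain rfl := hf _ _ _ ha ha'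
    exact Option.some_inj.1 (hx.symm.trans hx')
  · obtain ⟨x, hx⟩ := hx
    rw [h.right_eq_of_mem hx] at hb
    obtain ⟨a, -, hy⟩ := Option.bind_eq_some_iff.1 hb
    exact absurd hy (h.disj _ _ hb' (not_exists.1 hx') a)
  · obtain ⟨x, hx'⟩ := hx'
    rw [h.right_eq_of_mem hx'] at hb'
    obtain ⟨a, -, hy⟩ := Option.bind_eq_some_iff.1 hb'
    exact absurd hy (h.disj _ _ hb (not_exists.1 hx) a)
  · exact h.inj_right _ _ _ hb hb' (not_exists.1 hx) (not_exists.1 hx')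

end PGlue

variable {L A B : Type*}

/-- The map from `B` into the gluing of `A` and `B` along `f` and `k`. -/
noncomputable def glueIn (f : L → Option A) (k : L → Option B) (b : B) :
    Option (A ⊕ {b : B // ∀ x, k x ≠ some b}) :=
  open Classical in
  if h : ∃ x, k x = some b then (f h.choose).map Sum.inl else some (Sum.inr ⟨b, not_exists.1 h⟩)

variable {f : L → Option A} {k : L → Option B}

theorem glueIn_of_mem (hk : ∀ x x' y, k x = some y → k x' = some y → x = x') {x : L} {b : B}
    (h : k x = some b) : glueIn f k b = (f x).map Sum.inl := by
  have h' : ∃ x, k x = some b := ⟨x, h⟩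
  rw [glueIn, dif_pos h', hk _ _ _ h'.choose_spec h]

theorem glueIn_of_not_mem {b : B} (h : ∀ x, k x ≠ some b) :
    glueIn f k b = some (Sum.inr ⟨b, h⟩) := by
  rw [glueIn, dif_neg (not_exists.2 h)]

/-- The set-level form of the universal property: the mediating map restricts to `t` on the right
part. -/
theorem glueIn_bind {C : Type*} (hk : ∀ x x' y, k x = some y → k x' = some y → x = x')
    {s : A → Option C} {t : B → Option C} (h : ∀ x, (f x).bind s = (k x).bind t) (b : B) :
    (glueIn f k b).bind (Sum.elim s fun b => t b.1) = t b := by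
  by_cases hb : ∃ x, k x = some b
  · obtain ⟨x, hx⟩ := hb
    have h1 := h x
    rw [hx, Option.bind_some] at h1
    rw [glueIn_of_mem hk hx, ← h1]
    cases f x <;> rfl
  · rw [glueIn_of_not_mem (not_exists.1 hb)]
    rfl

end Glue

/-! ### Explicit pushouts along total injective morphisms, and their consequences -/

section Pushout

variable {Λ : Type v} {ar : Λ → ℕ} {L A B P : HGraph.{v, u} ar}

/-- The edges of the gluing of `A` and `B` along `f` and `k`. -/
abbrev GlueEdge (f : L ⟶ A) (k : L ⟶ B) : Type u :=
  A.E ⊕ {e : B.E // (∀ x, edgeMap k x ≠ some e) ∧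
    ∀ b ∈ B.conn e, (glueIn (nodeMap f) (nodeMap k) b).isSome}

/-- The explicit pushout of a partial morphism `f` along a total injective morphism `k`. -/
noncomputable def glue (f : L ⟶ A) (k : L ⟶ B) : HGraph.{v, u} ar where
  V := A.V ⊕ {b : B.V // ∀ x, nodeMap k x ≠ some b}
  E := GlueEdge f k
  finV := by
    have := A.finV
    have := B.finV
    infer_instance
  finE := by
    have := A.finE
    have := B.finE
    infer_instance
  conn := Sum.elim (fun e => (A.conn e).map Sum.inl)
    (fun e => (B.conn e.1).attach.map fun b =>
      (glueIn (nodeMap f) (nodeMap k) b.1).get (e.2.2 b.1 b.2))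
  lab := Sum.elim A.lab fun e => B.lab e.1
  conn_length := by
    rintro (e | e)
    · simpa using A.conn_length e
    · simpa using B.conn_length e.1

/-- The inclusion of the left part into a gluing. -/
noncomputable def glueLeft (f : L ⟶ A) (k : L ⟶ B) : A ⟶ glue f k where
  onV a := some (Sum.inl a)
  onE a := some (Sum.inl a)
  lab_eq := by
    rintro e _ ⟨⟩
    rfl
  conn_eq := by
    rintro e _ ⟨⟩
    simp [glue]

open Classical in
/-- The edge part of the morphism from the right part into a gluing. -/
noncomputable def glueRightEdge (f : L ⟶ A) (k : L ⟶ B) (e : B.E) : Option (GlueEdge f k) :=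
  if h : ∃ x, edgeMap k x = some e then (edgeMap f h.choose).map Sum.inl
  else if h' : ∀ b ∈ B.conn e, (glueIn (nodeMap f) (nodeMap k) b).isSome then
    some (Sum.inr ⟨e, not_exists.1 h, h'⟩)
  else none

theorem glueRightEdge_of_mem (f : L ⟶ A) {k : L ⟶ B} (hk : IsInj k) {x : L.E} {e : B.E}
    (h : edgeMap k x = some e) : glueRightEdge f k e = (edgeMap f x).map Sum.inl := by
  have h' : ∃ x, edgeMap k x = some e := ⟨x, h⟩
  rw [glueRightEdge, dif_pos h', hk.2 _ _ _ h'.choose_spec h]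

theorem glueRightEdge_of_not_mem (f : L ⟶ A) {k : L ⟶ B} {e : B.E}
    (h : ∀ x, edgeMap k x ≠ some e)
    (h' : ∀ b ∈ B.conn e, (glueIn (nodeMap f) (nodeMap k) b).isSome) :
    glueRightEdge f k e = some (Sum.inr ⟨e, h, h'⟩) := by
  rw [glueRightEdge, dif_neg (not_exists.2 h), dif_pos h']

theorem glueRightEdge_eq_none (f : L ⟶ A) {k : L ⟶ B} {e : B.E}
    (h : ∀ x, edgeMap k x ≠ some e)
    (h' : ¬∀ b ∈ B.conn e, (glueIn (nodeMap f) (nodeMap k) b).isSome) :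
    glueRightEdge f k e = none := by
  rw [glueRightEdge, dif_neg (not_exists.2 h), dif_neg h']

/-- The morphism from the right part into a gluing. -/
noncomputable def glueRight (f : L ⟶ A) (k : L ⟶ B) (ht : IsTotal k) (hk : IsInj k) :
    B ⟶ glue f k where
  onV := glueIn (nodeMap f) (nodeMap k)
  onE := glueRightEdge f k
  lab_eq := by
    intro e e' h
    by_cases hx : ∃ x, edgeMap k x = some e
    · obtain ⟨x, hx⟩ := hx
      rw [glueRightEdge_of_mem f hk hx] at h
      obtain ⟨a, ha, rfl⟩ := Option.map_eq_some_iff.1 h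
      exact (k.lab_eq _ _ hx).symm.trans (f.lab_eq _ _ ha)
    · by_cases h' : ∀ b ∈ B.conn e, (glueIn (nodeMap f) (nodeMap k) b).isSome
      · rw [glueRightEdge_of_not_mem f (not_exists.1 hx) h'] at h
        cases h
        rfl
      · rw [glueRightEdge_eq_none f (not_exists.1 hx) h'] at h
        cases h
  conn_eq := by
    intro e e' h
    by_cases hx : ∃ x, edgeMap k x = some e
    · obtain ⟨x, hx⟩ := hx
      rw [glueRightEdge_of_mem f hk hx] at h
      obtain ⟨a, ha, rfl⟩ := Option.map_eq_some_iff.1 h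
      have h1 := congrArg (List.map fun o : Option B.V =>
        o.bind (glueIn (nodeMap f) (nodeMap k))) (k.conn_eq _ _ hx)
      have h2 := congrArg (List.map fun o : Option A.V => o.map
        (Sum.inl : A.V → A.V ⊕ {b : B.V // ∀ x, nodeMap k x ≠ some b})) (f.conn_eq _ _ ha)
      simp only [List.map_map] at h1 h2
      refine Eq.trans h1.symm (Eq.trans (List.map_congr_left fun y _ => ?_)
        (h2.trans ?_))
      · obtain ⟨b, hb⟩ := ht.1 y
        change (nodeMap k y).bind _ = (nodeMap f y).map _
        rw [hb, Option.bind_some, glueIn_of_mem hk.1 hb]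
      · simp [glue, Function.comp_def]
    · by_cases h' : ∀ b ∈ B.conn e, (glueIn (nodeMap f) (nodeMap k) b).isSome
      · rw [glueRightEdge_of_not_mem f (not_exists.1 hx) h'] at h
        cases h
        simp [glue, Function.comp_def]
      · rw [glueRightEdge_eq_none f (not_exists.1 hx) h'] at h
        cases h

/-- The mediating morphism out of a gluing. -/
noncomputable def glueDesc {f : L ⟶ A} {k : L ⟶ B} (hk : IsInj k) {K : HGraph.{v, u} ar}
    (s : A ⟶ K) (t : B ⟶ K) (h : f ≫ s = k ≫ t) : glue f k ⟶ K where
  onV := Sum.elim (nodeMap s) fun b => nodeMap t b.1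
  onE := Sum.elim (edgeMap s) fun b => edgeMap t b.1
  lab_eq := by
    rintro (e | e) e' h
    · exact s.lab_eq _ _ h
    · exact t.lab_eq _ _ h
  conn_eq := by
    rintro (e | e) e' h'
    · have := s.conn_eq _ _ h'
      rw [← this]
      simp only [glue, Sum.elim_inl, List.map_map]
      rfl
    · have := t.conn_eq _ _ h'
      rw [← this]
      simp only [glue, Sum.elim_inr, List.map_map]
      refine Eq.trans ?_ (List.attach_map_val (l := B.conn e.1) (f := nodeMap t))
      refine List.map_congr_left fun b _ => ?_
      have h1 := glueIn_bind (f := nodeMap f) hk.1 (s := nodeMap s) (t := nodeMap t)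
        (fun x => congrFun (congrArg PMor.onV h) x) b.1
      rw [← Option.some_get (e.2.2 b.1 b.2)] at h1
      exact h1

/-- Nodes and edges glue separately, except that a new edge of `B` must be dropped when one of its
nodes has no image. This is forced: in any cocone, the right leg factors on nodes through the
gluing, so it is undefined at such a node and hence on the edge. -/
theorem isPushout_glue (f : L ⟶ A) (k : L ⟶ B) (ht : IsTotal k) (hk : IsInj k) :
    IsPushout f k (glueLeft f k) (glueRight f k ht hk) := by
  refine ⟨⟨?_⟩, ⟨Limits.PushoutCocone.IsColimit.mk _
    (fun s => glueDesc hk s.inl s.inr s.condition) (fun s => rfl) (fun s => ?_) ?_⟩⟩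
  · apply hom_ext
    · intro x
      obtain ⟨b, hb⟩ := ht.1 x
      have : nodeMap (glueRight f k ht hk) b = _ := glueIn_of_mem hk.1 hb
      simp only [nodeMap_comp, hb, Option.bind_some, this]
      cases nodeMap f x <;> rfl
    · intro x
      obtain ⟨b, hb⟩ := ht.2 x
      have : edgeMap (glueRight f k ht hk) b = _ := glueRightEdge_of_mem f hk hb
      simp only [edgeMap_comp, hb, Option.bind_some, this]
      cases edgeMap f x <;> rfl
  · have hV := glueIn_bind (f := nodeMap f) hk.1 (s := nodeMap s.inl) (t := nodeMap s.inr)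
        (fun x => congrFun (congrArg PMor.onV s.condition) x)
    apply hom_ext
    · exact hV
    · intro e
      change (glueRightEdge f k e).bind (Sum.elim (edgeMap s.inl) fun b => edgeMap s.inr b.1) = _
      by_cases hx : ∃ x, edgeMap k x = some e
      · obtain ⟨x, hx⟩ := hx
        have h1 : (edgeMap f x).bind (edgeMap s.inl) = (edgeMap k x).bind (edgeMap s.inr) :=
          congrFun (congrArg PMor.onE s.condition) x
        rw [hx, Option.bind_some] at h1
        rw [glueRightEdge_of_mem f hk hx, ← h1]
        cases edgeMap f x <;> rfl
      · by_cases h' : ∀ b ∈ B.conn e, (glueIn (nodeMap f) (nodeMap k) b).isSome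
        · rw [glueRightEdge_of_not_mem f (not_exists.1 hx) h']
          rfl
        · rw [glueRightEdge_eq_none f (not_exists.1 hx) h', Option.bind_none]
          cases ht' : edgeMap s.inr e with
          | none => rfl
          | some e' =>
            -- If the right leg were defined on the dropped edge, it would be defined on all its
            -- nodes, so all of them would have images in the gluing.
            refine absurd (fun b hb => ?_) h'
            obtain ⟨y, hy, -⟩ := exists_incident_image s.inr ht' hb
            have h1 := hV b
            rw [hy] at h1
            cases h2 : glueIn (nodeMap f) (nodeMap k) b with
            | none => rw [h2] at h1; cases h1
            | some z => rfl
  · intro s φ hl hr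
    apply hom_ext
    · rintro (a | b)
      · exact congrFun (congrArg PMor.onV hl) a
      · have h1 : (glueIn (nodeMap f) (nodeMap k) b.1).bind (nodeMap φ) = nodeMap s.inr b.1 :=
          congrFun (congrArg PMor.onV hr) b.1
        rw [glueIn_of_not_mem b.2] at h1
        exact h1
    · rintro (a | b)
      · exact congrFun (congrArg PMor.onE hl) a
      · have h1 : (glueRightEdge f k b.1).bind (edgeMap φ) = edgeMap s.inr b.1 :=
          congrFun (congrArg PMor.onE hr) b.1
        rw [glueRightEdge_of_not_mem f b.2.1 b.2.2] at h1
        exact h1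

theorem exists_isPushout (f : L ⟶ A) (k : L ⟶ B) (ht : IsTotal k) (hk : IsInj k) :
    ∃ (P : HGraph.{v, u} ar) (i : A ⟶ P) (j : B ⟶ P), IsPushout f k i j :=
  ⟨_, _, _, isPushout_glue f k ht hk⟩

variable {f : L ⟶ A} {k : L ⟶ B} {i : A ⟶ P} {j : B ⟶ P}

theorem pGlue_nodeMap (h : IsPushout f k i j) (ht : IsTotal k) (hk : IsInj k) :
    PGlue (nodeMap f) (nodeMap k) (nodeMap i) (nodeMap j) := by
  let φ := (isPushout_glue f k ht hk).isoIsPushout _ _ h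
  have hl : glueLeft f k ≫ φ.hom = i := IsPushout.inl_isoIsPushout_hom ..
  have hr : glueRight f k ht hk ≫ φ.hom = j := IsPushout.inr_isoIsPushout_hom ..
  have hφ := IsSubgraphMor.of_iso φ
  rw [← hl, ← hr]
  refine PGlue.comp_right (i := nodeMap (glueLeft f k)) (j := nodeMap (glueRight f k ht hk))
    ?_ (IsTotal.of_iso φ).1 hφ.1.1 hφ.2.1
  refine ⟨fun x => congrFun (congrArg PMor.onV (isPushout_glue f k ht hk).w) x,
    fun a => ⟨_, rfl⟩, ?_, ?_, ?_, ?_⟩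
  · rintro a a' _ ⟨⟩ ⟨⟩
    rfl
  · rintro (a | b)
    · exact Or.inl ⟨a, rfl⟩
    · exact Or.inr ⟨b.1, glueIn_of_not_mem b.2, b.2⟩
  · intro b y hb hx a ha
    have := (glueIn_of_not_mem hx).symm.trans (hb.trans ha.symm)
    cases this
  · intro b b' y hb hb' hx hx'
    have := (glueIn_of_not_mem hx).symm.trans (hb.trans (hb'.symm.trans (glueIn_of_not_mem hx')))
    cases this
    rfl

theorem pGlue_edgeMap (h : IsPushout f k i j) (ht : IsTotal k) (hk : IsInj k) :
    PGlue (edgeMap f) (edgeMap k) (edgeMap i) (edgeMap j) := by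
  let φ := (isPushout_glue f k ht hk).isoIsPushout _ _ h
  have hl : glueLeft f k ≫ φ.hom = i := IsPushout.inl_isoIsPushout_hom ..
  have hr : glueRight f k ht hk ≫ φ.hom = j := IsPushout.inr_isoIsPushout_hom ..
  have hφ := IsSubgraphMor.of_iso φ
  rw [← hl, ← hr]
  refine PGlue.comp_right (i := edgeMap (glueLeft f k)) (j := edgeMap (glueRight f k ht hk))
    ?_ (IsTotal.of_iso φ).2 hφ.1.2 hφ.2.2
  have hj : ∀ b y, edgeMap (glueRight f k ht hk) b = some y → (∀ x, edgeMap k x ≠ some b) →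
      ∃ h, y = Sum.inr ⟨b, h⟩ := by
    intro b y hb hx
    by_cases h' : ∀ v ∈ B.conn b, (glueIn (nodeMap f) (nodeMap k) v).isSome
    · have := (glueRightEdge_of_not_mem f hx h').symm.trans hb
      cases this
      exact ⟨⟨hx, h'⟩, rfl⟩
    · have := (glueRightEdge_eq_none f hx h').symm.trans hb
      cases this
  refine ⟨fun x => congrFun (congrArg PMor.onE (isPushout_glue f k ht hk).w) x,
    fun a => ⟨_, rfl⟩, ?_, ?_, ?_, ?_⟩
  · rintro a a' _ ⟨⟩ ⟨⟩
    rfl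
  · rintro (a | b)
    · exact Or.inl ⟨a, rfl⟩
    · exact Or.inr ⟨b.1, glueRightEdge_of_not_mem f b.2.1 b.2.2, b.2.1⟩
  · intro b y hb hx a ha
    obtain ⟨h', rfl⟩ := hj b y hb hx
    cases ha
  · intro b b' y hb hb' hx hx'
    obtain ⟨h', rfl⟩ := hj b y hb hx
    obtain ⟨h'', h3⟩ := hj b' _ hb' hx'
    cases h3
    rfl

theorem isTotal_inl (h : IsPushout f k i j) (ht : IsTotal k) (hk : IsInj k) : IsTotal i :=
  ⟨(pGlue_nodeMap h ht hk).total, (pGlue_edgeMap h ht hk).total⟩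

theorem isInj_inl (h : IsPushout f k i j) (ht : IsTotal k) (hk : IsInj k) : IsInj i :=
  ⟨(pGlue_nodeMap h ht hk).inj, (pGlue_edgeMap h ht hk).inj⟩

theorem isSubgraphMor_inr (h : IsPushout f k i j) (ht : IsTotal k) (hk : IsInj k)
    (hf : IsSubgraphMor f) : IsSubgraphMor j :=
  ⟨⟨(pGlue_nodeMap h ht hk).right_inj hf.1.1, (pGlue_edgeMap h ht hk).right_inj hf.1.2⟩,
    (pGlue_nodeMap h ht hk).right_surj ht.1 hf.2.1, (pGlue_edgeMap h ht hk).right_surj ht.2 hf.2.2⟩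

/-- With `f` total, every node of `B` has an image in the gluing, so no edge is dropped. -/
theorem isTotal_inr (h : IsPushout f k i j) (ht : IsTotal k) (hk : IsInj k) (hf : IsTotal f) :
    IsTotal j := by
  let φ := (isPushout_glue f k ht hk).isoIsPushout _ _ h
  have hr : glueRight f k ht hk ≫ φ.hom = j := IsPushout.inr_isoIsPushout_hom ..
  rw [← hr]
  refine IsTotal.comp ?_ (IsTotal.of_iso φ)
  have hV : ∀ b, ∃ y, glueIn (nodeMap f) (nodeMap k) b = some y := by
    intro b
    by_cases hx : ∃ x, nodeMap k x = some b
    · obtain ⟨x, hx⟩ := hx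
      obtain ⟨a, ha⟩ := hf.1 x
      exact ⟨Sum.inl a, by rw [glueIn_of_mem hk.1 hx, ha]; rfl⟩
    · exact ⟨_, glueIn_of_not_mem (not_exists.1 hx)⟩
  refine ⟨hV, fun e => ?_⟩
  by_cases hx : ∃ x, edgeMap k x = some e
  · obtain ⟨x, hx⟩ := hx
    obtain ⟨a, ha⟩ := hf.2 x
    refine ⟨Sum.inl a, (glueRightEdge_of_mem f hk hx).trans ?_⟩
    rw [ha]
    rfl
  · exact ⟨_, glueRightEdge_of_not_mem f (not_exists.1 hx)
      fun b _ => Option.isSome_iff_exists.2 (hV b)⟩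

/-- Retraction of the pushout onto its left part. -/
theorem exists_retraction (h : IsPushout f k i j) (ht : IsTotal k) (hk : IsInj k) :
    ∃ c : P ⟶ A, i ≫ c = 𝟙 A ∧ j ≫ c = invMor k hk ≫ f ∧ c = invMor i (isInj_inl h ht hk) := by
  have w : f ≫ 𝟙 A = k ≫ invMor k hk ≫ f := by
    rw [← Category.assoc, comp_invMor hk ht, Category.comp_id, Category.id_comp]
  refine ⟨h.desc _ _ w, h.inl_desc _ _ w, h.inr_desc _ _ w, ?_⟩
  -- Equality may be tested on both legs. On the right leg, elements outside the range of `k` never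
  -- land in the range of `i`, so both sides are undefined there.
  apply h.hom_ext
  · rw [h.inl_desc, comp_invMor _ (isTotal_inl h ht hk)]
  · rw [h.inr_desc]
    apply hom_ext
    · intro b
      by_cases hx : ∃ x, nodeMap k x = some b
      · obtain ⟨x, hx⟩ := hx
        rw [nodeMap_comp, nodeMap_comp, (nodeMap_invMor hk).2 hx, Option.bind_some,
          (pGlue_nodeMap h ht hk).right_eq_of_mem hx]
        cases hfx : nodeMap f x with
        | none => rfl
        | some a =>
          obtain ⟨y, hy⟩ := (isTotal_inl h ht hk).1 a
          rw [Option.bind_some, hy, Option.bind_some, (nodeMap_invMor _).2 hy]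
      · have h1 : nodeMap (invMor k hk) b = none :=
          Option.eq_none_iff_forall_ne_some.2 fun x hx' => hx ⟨x, (nodeMap_invMor hk).1 hx'⟩
        rw [nodeMap_comp, nodeMap_comp, h1, Option.bind_none]
        symm
        rw [Option.eq_none_iff_forall_ne_some]
        intro a ha
        obtain ⟨y, hy, hy'⟩ := Option.bind_eq_some_iff.1 ha
        exact (pGlue_nodeMap h ht hk).disj _ _ hy (not_exists.1 hx) a ((nodeMap_invMor _).1 hy')
    · intro b
      by_cases hx : ∃ x, edgeMap k x = some b
      · obtain ⟨x, hx⟩ := hx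
        rw [edgeMap_comp, edgeMap_comp, (edgeMap_invMor hk).2 hx, Option.bind_some,
          (pGlue_edgeMap h ht hk).right_eq_of_mem hx]
        cases hfx : edgeMap f x with
        | none => rfl
        | some a =>
          obtain ⟨y, hy⟩ := (isTotal_inl h ht hk).2 a
          rw [Option.bind_some, hy, Option.bind_some, (edgeMap_invMor _).2 hy]
      · have h1 : edgeMap (invMor k hk) b = none :=
          Option.eq_none_iff_forall_ne_some.2 fun x hx' => hx ⟨x, (edgeMap_invMor hk).1 hx'⟩
        rw [edgeMap_comp, edgeMap_comp, h1, Option.bind_none]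
        symm
        rw [Option.eq_none_iff_forall_ne_some]
        intro a ha
        obtain ⟨y, hy, hy'⟩ := Option.bind_eq_some_iff.1 ha
        exact (pGlue_edgeMap h ht hk).disj _ _ hy (not_exists.1 hx) a ((edgeMap_invMor _).1 hy')

end Pushout

/-! ### Leaving out one step of an instantiation -/

section Reduction

variable {Λ : Type v} {ar : Λ → ℕ}

section UnivQuant

variable {L : HGraph.{v, u} ar} (w : UnivQuant L)

theorem UnivQuant.isTotal_comp : IsTotal (w.p ≫ w.q) := by
  constructor
  · intro x
    obtain ⟨y, hy⟩ := w.p_total.1 x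
    obtain ⟨z, hz, -⟩ := w.q_node x y hy
    exact ⟨z, by simp [hy, hz]⟩
  · intro x
    obtain ⟨y, hy⟩ := w.p_total.2 x
    obtain ⟨z, hz, -⟩ := w.q_edge x y hy
    exact ⟨z, by simp [hy, hz]⟩

theorem UnivQuant.nodeMap_p_of_comp {x : L.V} {y : w.Lu.V} {z : w.Ru.V}
    (h : nodeMap (w.p ≫ w.q) x = some z) (hz : nodeMap w.q y = some z) :
    nodeMap w.p x = some y := by
  obtain ⟨y', hy', hz'⟩ := Option.bind_eq_some_iff.1 h
  obtain ⟨z', h1, h2⟩ := w.q_node x y' hy'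
  obtain rfl := Option.some_inj.1 (h1.symm.trans hz')
  rw [h2 y hz]
  exact hy'

theorem UnivQuant.edgeMap_p_of_comp {x : L.E} {y : w.Lu.E} {z : w.Ru.E}
    (h : edgeMap (w.p ≫ w.q) x = some z) (hz : edgeMap w.q y = some z) :
    edgeMap w.p x = some y := by
  obtain ⟨y', hy', hz'⟩ := Option.bind_eq_some_iff.1 h
  obtain ⟨z', h1, h2⟩ := w.q_edge x y' hy'
  obtain rfl := Option.some_inj.1 (h1.symm.trans hz')
  rw [h2 y hz]
  exact hy'

/-- The unique-preimage condition on `q` makes `p ≫ q` injective although `q` need not be; together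
with totality this puts the right-hand pushouts in the scope of the explicit gluing. -/
theorem UnivQuant.isInj_comp : IsInj (w.p ≫ w.q) := by
  constructor
  · intro x x' z h h'
    obtain ⟨y, hy, hz⟩ := Option.bind_eq_some_iff.1 h
    exact w.p_inj.1 _ _ _ hy (w.nodeMap_p_of_comp h' hz)
  · intro x x' z h h'
    obtain ⟨y, hy, hz⟩ := Option.bind_eq_some_iff.1 h
    exact w.p_inj.2 _ _ _ hy (w.edgeMap_p_of_comp h' hz)

/-- Again by unique preimages, `q` sends nothing outside the range of `p` into the range of `p ≫ q`.
This makes the retractions of the left and right pushouts compatible. -/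
theorem UnivQuant.comp_invMor : w.q ≫ invMor (w.p ≫ w.q) w.isInj_comp = invMor w.p w.p_inj := by
  apply hom_ext
  · intro y
    ext x
    rw [nodeMap_invMor, nodeMap_comp, Option.bind_eq_some_iff]
    constructor
    · rintro ⟨z, hz, h⟩
      exact w.nodeMap_p_of_comp ((nodeMap_invMor _).1 h) hz
    · intro h
      obtain ⟨z, hz, -⟩ := w.q_node x y h
      exact ⟨z, hz, (nodeMap_invMor _).2 (by simp [h, hz])⟩
  · intro y
    ext x
    rw [edgeMap_invMor, edgeMap_comp, Option.bind_eq_some_iff]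
    constructor
    · rintro ⟨z, hz, h⟩
      exact w.edgeMap_p_of_comp ((edgeMap_invMor _).1 h) hz
    · intro h
      obtain ⟨z, hz, -⟩ := w.q_edge x y h
      exact ⟨z, hz, (edgeMap_invMor _).2 (by simp [h, hz])⟩

end UnivQuant

/-- `i` adds edges only at nodes that it adds as well. -/
def AddsEdgesAtAddedNodes {A P : HGraph.{v, u} ar} (i : A ⟶ P) : Prop :=
  ∀ e : P.E, (∀ d, edgeMap i d ≠ some e) → ∃ y : P.V, Incident P e y ∧ ∀ x, nodeMap i x ≠ some y

/-- A new edge of `P` comes from an edge of `B` outside the range of `k`; an incident new node of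
`B` is mapped along with it, and stays outside the range of `i`. -/
theorem AddsEdgesAtAddedNodes.of_isPushout {L A B P : HGraph.{v, u} ar} {f : L ⟶ A} {k : L ⟶ B}
    {i : A ⟶ P} {j : B ⟶ P} (hk : AddsEdgesAtAddedNodes k) (h : IsPushout f k i j)
    (ht : IsTotal k) (hi : IsInj k) : AddsEdgesAtAddedNodes i := by
  intro e he
  rcases (pGlue_edgeMap h ht hi).cover e with ⟨a, ha⟩ | ⟨b, hb, hb'⟩
  · exact absurd ha (he a)
  · obtain ⟨z, hz, hz'⟩ := hk b hb'
    obtain ⟨y, hy, hy'⟩ := exists_incident_image j hb hz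
    exact ⟨y, hy', (pGlue_nodeMap h ht hi).disj _ _ hy hz'⟩

variable {ρ : UQRule.{v, u} ar}

/-- The right side of a step is obtained from the right side of the step from `(𝟙, r)`. -/
theorem exists_isPushout_of_step (hρ : NewEdgesAtNewNodes ρ) {w : UnivQuant ρ.L} (hw : w ∈ ρ.U)
    {L₁ R₁ R₂ : HGraph.{v, u} ar} {π : ρ.L ⟶ L₁} {γ : L₁ ⟶ R₁} {ι : ρ.R ⟶ R₁}
    (hι : π ≫ γ = ρ.r ≫ ι) {i : R₁ ⟶ R₂} {j : w.Ru ⟶ R₂}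
    (h : IsPushout (π ≫ γ) (w.p ≫ w.q) i j) :
    ∃ (R₀ : HGraph.{v, u} ar) (i₀ : ρ.R ⟶ R₀) (t : R₀ ⟶ R₂), IsTotal i₀ ∧ IsInj i₀ ∧
      IsPushout ι i₀ i t ∧ AddsEdgesAtAddedNodes i₀ := by
  obtain ⟨R₀, i₀, j₀, h₀⟩ := exists_isPushout ρ.r (w.p ≫ w.q) w.isTotal_comp w.isInj_comp
  obtain ⟨L₀, p₀, π₀, hL₀⟩ := exists_isPushout (𝟙 ρ.L) w.p w.p_total w.p_inj
  have hstep : IsInstStep (𝟙 ρ.L) ρ.r w p₀ i₀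
      (hL₀.desc (ρ.r ≫ i₀) (w.q ≫ j₀) (by
        rw [Category.id_comp, h₀.w, Category.assoc])) :=
    ⟨π₀, j₀, hL₀, by rwa [Category.id_comp], hL₀.inl_desc _ _ _, hL₀.inr_desc _ _ _⟩
  have hw' : ρ.r ≫ ι ≫ i = (w.p ≫ w.q) ≫ j := by rw [← Category.assoc, ← hι, h.w]
  refine ⟨R₀, i₀, h₀.desc (ι ≫ i) j hw', isTotal_inl h₀ w.isTotal_comp w.isInj_comp,
    isInj_inl h₀ w.isTotal_comp w.isInj_comp, ?_, hρ w hw _ _ _ _ _ hstep⟩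
  -- Since `π ≫ γ = ρ.r ≫ ι`, the right-hand pushout of the step is a pasting whose left square is
  -- the pushout of the first step; cancelling that square leaves the pushout along `ι`.
  refine IsPushout.of_left (h₁₁ := ρ.r) (v₁₁ := w.p ≫ w.q) (h₂₁ := j₀) ?_
    (h₀.inl_desc _ _ _).symm h₀
  rwa [h₀.inr_desc, ← hι]

/-- A shorter instantiation, together with subgraph morphisms `c` and `d` that forget the part of
the instantiation `(π, γ)` of length `n` created by the step with number `s`. The map `idx` sends
every node to the number of the step that created it. -/
def HasReduction {L₁ R₁ : HGraph.{v, u} ar} (ι : ρ.R ⟶ R₁) (π : ρ.L ⟶ L₁) (γ : L₁ ⟶ R₁)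
    (idx : R₁.V → ℕ) (n s : ℕ) : Prop :=
  ∃ n' < n, ∃ (L' R' : HGraph.{v, u} ar) (π' : ρ.L ⟶ L') (γ' : L' ⟶ R') (c : L₁ ⟶ L')
    (d : R₁ ⟶ R'), IsInst ρ n' π' γ' ∧ IsSubgraphMor c ∧ IsSubgraphMor d ∧ π ≫ c = π' ∧
      c ≫ γ' = γ ≫ d ∧ IsTotal (ι ≫ d) ∧ (∀ y, nodeMap d y = none → idx y = s) ∧
      ∀ e, edgeMap d e = none → ∃ y, Incident R₁ e y ∧ nodeMap d y = none

section Step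

variable {w : UnivQuant ρ.L} {L₁ R₁ L₂ R₂ : HGraph.{v, u} ar} {π : ρ.L ⟶ L₁} {γ : L₁ ⟶ R₁}
  {ι : ρ.R ⟶ R₁} {p' : L₁ ⟶ L₂} {i : R₁ ⟶ R₂} {η : L₂ ⟶ R₂} {n : ℕ} {idx : R₂.V → ℕ}

/-- The retractions of the two pushouts onto their old parts forget exactly what the last step
added, and the old instantiation is the shorter one. -/
theorem hasReduction_last (hρ : NewEdgesAtNewNodes ρ) (hw : w ∈ ρ.U) (hinst : IsInst ρ n π γ)
    (hι : IsTotal ι) (hιr : π ≫ γ = ρ.r ≫ ι) (hstep : IsInstStep π γ w p' i η)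
    (hidx : ∀ y, (∀ x, nodeMap i x ≠ some y) → idx y = n) :
    HasReduction (ι ≫ i) (π ≫ p') η idx (n + 1) n := by
  obtain ⟨π', j, hL, hR, hη, hη'⟩ := hstep
  obtain ⟨c, hc, hc', hci⟩ := exists_retraction hL w.p_total w.p_inj
  obtain ⟨d, hd, hd', hdi⟩ := exists_retraction hR w.isTotal_comp w.isInj_comp
  have hpt := isTotal_inl hL w.p_total w.p_inj
  have hpi := isInj_inl hL w.p_total w.p_inj
  have hit := isTotal_inl hR w.isTotal_comp w.isInj_comp
  have hii := isInj_inl hR w.isTotal_comp w.isInj_comp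
  obtain ⟨R₀, i₀, t, hi₀t, hi₀i, hsq, hnew⟩ := exists_isPushout_of_step hρ hw hιr hR
  have hnodes : ∀ y, nodeMap d y = none ↔ ∀ x, nodeMap i x ≠ some y := by
    intro y
    rw [Option.eq_none_iff_forall_ne_some]
    refine forall_congr' fun x => not_congr ?_
    rw [hdi, nodeMap_invMor]
  have hedges : ∀ y, edgeMap d y = none ↔ ∀ x, edgeMap i x ≠ some y := by
    intro y
    rw [Option.eq_none_iff_forall_ne_some]
    refine forall_congr' fun x => not_congr ?_
    rw [hdi, edgeMap_invMor]
  refine ⟨n, n.lt_succ_self, L₁, R₁, π, γ, c, d, hinst, ?_, ?_, ?_, ?_, ?_, ?_, ?_⟩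
  · rw [hci]
    exact ⟨hpi.invMor, IsSurj.invMor hpi hpt⟩
  · rw [hdi]
    exact ⟨hii.invMor, IsSurj.invMor hii hit⟩
  · rw [Category.assoc, hc, Category.comp_id]
  · apply hL.hom_ext
    · rw [← Category.assoc, hc, Category.id_comp, ← Category.assoc, hη, Category.assoc, hd,
        Category.comp_id]
    -- On the leg from `w.Lu` both sides equal the inverse of `w.p` followed by `π ≫ γ`.
    · rw [← Category.assoc, hc', ← Category.assoc, hη', Category.assoc, Category.assoc, hd',
        ← w.comp_invMor, Category.assoc]
  · rwa [Category.assoc, hd, Category.comp_id]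
  · exact fun y hy => hidx y ((hnodes y).1 hy)
  · intro e he
    obtain ⟨y, hy, hy'⟩ := hnew.of_isPushout hsq hi₀t hi₀i e ((hedges e).1 he)
    exact ⟨y, hy, (hnodes y).2 hy'⟩

/-- The same quantification is applied to the shorter instantiation. By cancelling pushout squares,
the new `c'` and `d'` are pushouts of `c` and `d`, so they are again subgraph morphisms and forget
only images of what was forgotten before. -/
theorem HasReduction.step (hρ : NewEdgesAtNewNodes ρ) (hw : w ∈ ρ.U) {idx₁ : R₁.V → ℕ} {s : ℕ}
    (hιr : π ≫ γ = ρ.r ≫ ι) (hstep : IsInstStep π γ w p' i η)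
    (hidx : ∀ x y, nodeMap i x = some y → idx y = idx₁ x)
    (h : HasReduction ι π γ idx₁ n s) :
    HasReduction (ι ≫ i) (π ≫ p') η idx (n + 1) s := by
  obtain ⟨π', j, hL, hR, hη, hη'⟩ := hstep
  obtain ⟨n', hn', L', R', πh, γh, c, d, hinst, hc, hd, rfl, hcd, hιd, hnode, hedge⟩ := h
  have hpt := isTotal_inl hL w.p_total w.p_inj
  have hpi := isInj_inl hL w.p_total w.p_inj
  have hit := isTotal_inl hR w.isTotal_comp w.isInj_comp
  have hii := isInj_inl hR w.isTotal_comp w.isInj_comp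
  obtain ⟨Lh, ph, πh', hLh⟩ := exists_isPushout (π ≫ c) w.p w.p_total w.p_inj
  obtain ⟨Rh, ih, jh, hRh⟩ :=
    exists_isPushout ((π ≫ c) ≫ γh) (w.p ≫ w.q) w.isTotal_comp w.isInj_comp
  have hcomp : (π ≫ c) ≫ γh = (π ≫ γ) ≫ d := by
    rw [Category.assoc, hcd, Category.assoc]
  have hwc : π ≫ c ≫ ph = w.p ≫ πh' := by rw [← Category.assoc, hLh.w]
  have hwd : (π ≫ γ) ≫ d ≫ ih = (w.p ≫ w.q) ≫ jh := by rw [← Category.assoc, ← hcomp, hRh.w]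
  have hwη : (π ≫ c) ≫ γh ≫ ih = w.p ≫ w.q ≫ jh := by
    rw [← Category.assoc, hRh.w, Category.assoc]
  let c' := hL.desc (c ≫ ph) πh' hwc
  let d' := hR.desc (d ≫ ih) jh hwd
  let ηh := hLh.desc (γh ≫ ih) (w.q ≫ jh) hwη
  have hpc : p' ≫ c' = c ≫ ph := hL.inl_desc _ _ _
  have hπc : π' ≫ c' = πh' := hL.inr_desc _ _ _
  have hid : i ≫ d' = d ≫ ih := hR.inl_desc _ _ _
  have hjd : j ≫ d' = jh := hR.inr_desc _ _ _
  have hpη : ph ≫ ηh = γh ≫ ih := hLh.inl_desc _ _ _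
  have hπη : πh' ≫ ηh = w.q ≫ jh := hLh.inr_desc _ _ _
  have hsqL : IsPushout c p' ph c' :=
    IsPushout.of_left (by rwa [hπc]) hpc.symm hL
  have hsqR : IsPushout d i ih d' :=
    IsPushout.of_left (by rwa [hjd, ← hcomp]) hid.symm hR
  have hiht := isTotal_inl hRh w.isTotal_comp w.isInj_comp
  obtain ⟨R₀, i₀, t, hi₀t, hi₀i, hsq, -⟩ := exists_isPushout_of_step hρ hw hιr hR
  -- The pasted square is the pushout of the total morphism `ι ≫ d` along `i₀`. Thus `d'` forgets
  -- nothing in the image of `t`, which contains everything this step adds; this is why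
  -- `HasReduction` records totality of `ι ≫ d`.
  have htd : IsTotal (t ≫ d') := isTotal_inr (hsq.paste_horiz hsqR) hi₀t hi₀i hιd
  refine ⟨n' + 1, Nat.succ_lt_succ hn', Lh, Rh, (π ≫ c) ≫ ph, ηh, c', d',
    IsInst.step w hinst hw ⟨πh', jh, hLh, hRh, hpη, hπη⟩, isSubgraphMor_inr hsqL hpt hpi hc,
    isSubgraphMor_inr hsqR hit hii hd, ?_, ?_, ?_, ?_, ?_⟩
  · rw [Category.assoc, hpc, Category.assoc]
  · apply hL.hom_ext
    · rw [← Category.assoc, hpc, Category.assoc, hpη, ← Category.assoc, hcd, ← Category.assoc,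
        hη, Category.assoc, Category.assoc, hid]
    · rw [← Category.assoc, hπc, hπη, ← Category.assoc, hη', Category.assoc, hjd]
  · rw [Category.assoc, hid, ← Category.assoc]
    exact hιd.comp hiht
  · intro y hy
    rcases (pGlue_nodeMap hsq hi₀t hi₀i).cover y with ⟨x, hx⟩ | ⟨b, hb, -⟩
    · rw [hidx x y hx]
      apply hnode
      have h1 := congrArg (fun f => nodeMap f x) hid
      simp only [nodeMap_comp, hx, Option.bind_some, hy] at h1
      cases hdx : nodeMap d x with
      | none => rfl
      | some a =>
        obtain ⟨z, hz⟩ := hiht.1 a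
        rw [hdx, Option.bind_some, hz] at h1
        cases h1
    · obtain ⟨z, hz⟩ := htd.1 b
      rw [nodeMap_comp, hb, Option.bind_some, hy] at hz
      cases hz
  · intro e he
    rcases (pGlue_edgeMap hsq hi₀t hi₀i).cover e with ⟨x, hx⟩ | ⟨b, hb, -⟩
    · have h1 := congrArg (fun f => edgeMap f x) hid
      simp only [edgeMap_comp, hx, Option.bind_some, he] at h1
      have hdx : edgeMap d x = none := by
        cases hdx : edgeMap d x with
        | none => rfl
        | some a =>
          obtain ⟨z, hz⟩ := hiht.2 a
          rw [hdx, Option.bind_some, hz] at h1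
          cases h1
      obtain ⟨y, hy, hdy⟩ := hedge x hdx
      obtain ⟨y', hy', hinc⟩ := exists_incident_image i hx hy
      refine ⟨y', hinc, ?_⟩
      have h2 := congrArg (fun f => nodeMap f y) hid
      simpa only [nodeMap_comp, hy', Option.bind_some, hdy, Option.bind_none] using h2
    · obtain ⟨z, hz⟩ := htd.2 b
      rw [edgeMap_comp, hb, Option.bind_some, he] at hz
      cases hz

end Step

theorem IsInst.hasReduction (hρ : NewEdgesAtNewNodes ρ) {n : ℕ} {L₁ R₁ : HGraph.{v, u} ar}
    {π : ρ.L ⟶ L₁} {γ : L₁ ⟶ R₁} (h : IsInst ρ n π γ) :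
    ∃ ι : ρ.R ⟶ R₁, IsTotal ι ∧ π ≫ γ = ρ.r ≫ ι ∧ ∃ idx : R₁.V → ℕ,
      ∀ s < n, HasReduction ι π γ idx n s := by
  induction h with
  | base =>
    -- Nodes of `ρ.R` share the number `0` with the first step. This is harmless, as only forgotten
    -- nodes are required to carry the number `s`.
    exact ⟨𝟙 _, IsTotal.id _, by rw [Category.id_comp, Category.comp_id], fun _ => 0,
      fun s hs => absurd hs s.not_lt_zero⟩
  | @step n L₁ R₁ L₂ R₂ π γ p' i η w hinst hw hstep ih =>
    obtain ⟨ι, hι, hιr, idx, hidx⟩ := ih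
    have hR := hstep
    obtain ⟨π', j, -, hR, hη, -⟩ := hR
    have hit := isTotal_inl hR w.isTotal_comp w.isInj_comp
    have hii := isInj_inl hR w.isTotal_comp w.isInj_comp
    -- Old nodes keep their number; a node without preimage under `i` gets the default `n`, the
    -- number of the current step when counting from `0`.
    refine ⟨ι ≫ i, hι.comp hit, ?_, fun y => (nodeMap (invMor i hii) y).elim n idx, ?_⟩
    · rw [Category.assoc, hη, ← Category.assoc, hιr, Category.assoc]
    · intro s hs
      rcases Nat.lt_succ_iff_lt_or_eq.1 hs with hs | rfl
      · refine HasReduction.step hρ hw hιr hstep (fun x y hx => ?_) (hidx s hs)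
        simp only [(nodeMap_invMor hii).2 hx, Option.elim_some]
      · refine hasReduction_last hρ hw hinst hι hιr hstep fun y hy => ?_
        have : nodeMap (invMor i hii) y = none := by
          rw [Option.eq_none_iff_forall_ne_some]
          exact fun x hx => hy x ((nodeMap_invMor hii).1 hx)
        simp only [this, Option.elim_none]

end Reduction

/-! ### Descending the backward step to a shorter instantiation -/

section InstantiationBound

variable {Λ : Type v} {ar : Λ → ℕ}

theorem SubOrder.refl (G : HGraph.{v, u} ar) : SubOrder G G := ⟨𝟙 G, IsSubgraphMor.id G⟩

theorem SubOrder.trans {G₁ G₂ G₃ : HGraph.{v, u} ar} (h : SubOrder G₁ G₂) (h' : SubOrder G₂ G₃) :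
    SubOrder G₁ G₃ := by
  obtain ⟨μ, hμ⟩ := h
  obtain ⟨ν, hν⟩ := h'
  exact ⟨ν ≫ μ, hν.comp hμ⟩

theorem MatchLE.trans {L H₁ H₂ H₃ : HGraph.{v, u} ar} {m₁ : L ⟶ H₁} {m₂ : L ⟶ H₂} {m₃ : L ⟶ H₃}
    (h : MatchLE m₁ m₂) (h' : MatchLE m₂ m₃) : MatchLE m₁ m₃ := by
  obtain ⟨μ, hμ, rfl⟩ := h
  obtain ⟨ν, hν, rfl⟩ := h'
  exact ⟨ν ≫ μ, hν.comp hμ, by rw [Category.assoc]⟩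

theorem incident_preimage_of_isInj {H K : HGraph.{v, u} ar} {σ : H ⟶ K} (hσ : IsInj σ) {e : H.E}
    {e' : K.E} (he : edgeMap σ e = some e') {x : H.V} {x' : K.V} (hx : nodeMap σ x = some x')
    (h : Incident K e' x') : Incident H e x := by
  obtain ⟨y, hy, hinc⟩ := exists_incident_preimage σ he h
  rwa [hσ.1 _ _ _ hx hy]

theorem PathBounded.of_subOrder {k : ℕ∞} {G H : HGraph.{v, u} ar} (hH : PathBounded k H)
    (h : SubOrder G H) : PathBounded k G := by
  obtain ⟨σ, hi, hs⟩ := h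
  intro n x e hx he hinc
  choose fV hfV using hs.1
  choose fE hfE using hs.2
  refine hH n (fV ∘ x) (fE ∘ e) (fun a b hab => hx ?_) (fun a b hab => he ?_) fun a =>
    ⟨incident_preimage_of_isInj hi (hfE _) (hfV _) (hinc a).1,
      incident_preimage_of_isInj hi (hfE _) (hfV _) (hinc a).2⟩
  · exact Option.some_inj.1 (by rw [← hfV (x a), ← hfV (x b)]; exact congrArg _ hab)
  · exact Option.some_inj.1 (by rw [← hfE (e a), ← hfE (e b)]; exact congrArg _ hab)

/-- An edge of `K` at a quantified node lifts through `σ` to an edge of `H` at the corresponding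
node. That edge is matched by an edge of `L₁`, whose image under `c` then matches the original edge.
-/
theorem AppCond.of_isSubgraphMor {ρ : UQRule.{v, u} ar} {L₁ L' H K : HGraph.{v, u} ar}
    {π : ρ.L ⟶ L₁} {m : L₁ ⟶ H} {c : L₁ ⟶ L'} {m' : L' ⟶ K} {σ : H ⟶ K} (h : AppCond ρ π m)
    (hσ : IsSubgraphMor σ) (hm : m ≫ σ = c ≫ m') : AppCond ρ (π ≫ c) m' := by
  intro x hx y hy e he
  rw [Category.assoc, ← hm, ← Category.assoc] at hy
  obtain ⟨z, hz, hzy⟩ := Option.bind_eq_some_iff.1 hy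
  obtain ⟨e', he'⟩ := hσ.2.2 e
  obtain ⟨d, hd⟩ := h x hx z hz e' (incident_preimage_of_isInj hσ.1 he' hzy he)
  have h1 : edgeMap (c ≫ m') d = some e := by rw [← hm, edgeMap_comp, hd, Option.bind_some, he']
  obtain ⟨d', -, hd'⟩ := Option.bind_eq_some_iff.1 h1
  exact ⟨d', hd'⟩

theorem IsSubgraphMor.card_le {H K : HGraph.{v, u} ar} {σ : H ⟶ K} (hσ : IsSubgraphMor σ) :
    Nat.card K.V ≤ Nat.card H.V ∧ Nat.card K.E ≤ Nat.card H.E := by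
  have := H.finV
  have := H.finE
  choose fV hfV using hσ.2.1
  choose fE hfE using hσ.2.2
  refine ⟨Nat.card_le_card_of_injective fV fun a b hab => ?_,
    Nat.card_le_card_of_injective fE fun a b hab => ?_⟩
  · exact Option.some_inj.1 (by rw [← hfV a, ← hfV b, hab])
  · exact Option.some_inj.1 (by rw [← hfE a, ← hfE b, hab])

theorem IsSubgraphMor.isTotal_of_card_le {H K : HGraph.{v, u} ar} {σ : H ⟶ K}
    (hσ : IsSubgraphMor σ) (hc : Nat.card H.V + Nat.card H.E ≤ Nat.card K.V + Nat.card K.E) :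
    IsTotal σ := by
  have hle := hσ.card_le
  have := H.finV
  have := H.finE
  have := K.finV
  have := K.finE
  choose fV hfV using hσ.2.1
  choose fE hfE using hσ.2.2
  have hV : Function.Injective fV := fun a b hab =>
    Option.some_inj.1 (by rw [← hfV a, ← hfV b, hab])
  have hE : Function.Injective fE := fun a b hab =>
    Option.some_inj.1 (by rw [← hfE a, ← hfE b, hab])
  have hV' := (hV.bijective_of_nat_card_le (by omega)).2
  have hE' := (hE.bijective_of_nat_card_le (by omega)).2
  constructor
  · intro x
    obtain ⟨y, rfl⟩ := hV' x
    exact ⟨y, hfV y⟩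
  · intro x
    obtain ⟨y, rfl⟩ := hE' x
    exact ⟨y, hfE y⟩

/-- Graphs are finite, so a complement below `m` of least total size exists. A subgraph morphism
from it to a smaller complement cannot lose anything, hence is total and its inverse gives the
reverse comparison. -/
theorem IsPOC.exists_isMinPOC {L₁ R' G H : HGraph.{v, u} ar} {f : L₁ ⟶ R'} {g : R' ⟶ G}
    {m : L₁ ⟶ H} (h : IsPOC f g m) :
    ∃ (H' : HGraph.{v, u} ar) (m' : L₁ ⟶ H'), IsMinPOC f g m' ∧ MatchLE m' m := by
  let P : ℕ → Prop := fun N => ∃ (H' : HGraph.{v, u} ar) (m' : L₁ ⟶ H'),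
    IsPOC f g m' ∧ MatchLE m' m ∧ Nat.card H'.V + Nat.card H'.E = N
  have hP : ∃ N, P N := ⟨_, H, m, h, ⟨𝟙 H, IsSubgraphMor.id H, Category.comp_id m⟩, rfl⟩
  classical
  obtain ⟨H', m', hpoc, hle, hcard⟩ := Nat.find_spec hP
  refine ⟨H', m', ⟨hpoc, fun H₃ m₃ hpoc₃ hle₃ => ?_⟩, hle⟩
  have hmin := Nat.find_min' hP ⟨H₃, m₃, hpoc₃, hle₃.trans hle, rfl⟩
  obtain ⟨ν, hν, rfl⟩ := hle₃
  have ht := hν.isTotal_of_card_le (by omega)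
  refine ⟨invMor ν hν.1, ⟨hν.1.invMor, IsSurj.invMor hν.1 ht⟩, ?_⟩
  rw [Category.assoc, comp_invMor hν.1 ht, Category.comp_id]

/-- If the co-match avoids everything that `d` forgets, the parts of the instantiation forgotten by
`c` and `d` can be dropped from a backward step. -/
theorem exists_mem_backward_of_factors {ρ : UQRule.{v, u} ar} {k : ℕ∞} {n' : ℕ}
    {G H L₁ R₁ L' R' S : HGraph.{v, u} ar} {π : ρ.L ⟶ L₁} {γ : L₁ ⟶ R₁} {γ' : L' ⟶ R'}
    {c : L₁ ⟶ L'} {d : R₁ ⟶ R'} {μ' : R' ⟶ S} {g : S ⟶ G} {m : L₁ ⟶ H}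
    (hinst : IsInst ρ n' (π ≫ c) γ') (hc : IsSubgraphMor c) (hcd : c ≫ γ' = γ ≫ d)
    (hμ : IsSubgraphMor μ') (hgt : IsTotal g) (hgi : IsInj g)
    (hpoc : IsPOC (γ ≫ d ≫ μ') g m) (hk : PathBounded k H) (happ : AppCond ρ π m) :
    ∃ H' ∈ backward ρ k n' G, SubOrder H' H := by
  obtain ⟨hmt, hmi, ψ, hψ⟩ := hpoc
  obtain ⟨K, m₁, ν, hK⟩ := exists_isPushout c m hmt hmi
  have hν := isSubgraphMor_inr hK hmt hmi hc
  have hw : c ≫ (γ' ≫ μ') ≫ g = m ≫ ψ := by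
    rw [← hψ.w, ← Category.assoc, ← Category.assoc c, hcd, Category.assoc γ]
  have hcomp : c ≫ γ' ≫ μ' = γ ≫ d ≫ μ' := by
    rw [← Category.assoc, hcd, Category.assoc]
  have hpoc' : IsPOC (γ' ≫ μ') g m₁ := by
    refine ⟨isTotal_inl hK hmt hmi, isInj_inl hK hmt hmi, hK.desc _ _ hw, ?_⟩
    -- The given pushout for `γ ≫ d ≫ μ' = c ≫ γ' ≫ μ'` has the square of `c` and `m` as its left
    -- part; what remains is the complement for the shorter instantiation.
    refine IsPushout.of_left (h₁₁ := c) (v₁₁ := m) (h₂₁ := ν) ?_ (hK.inl_desc _ _ _).symm hK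
    rwa [hK.inr_desc, hcomp]
  obtain ⟨H', m', hmin, τ, hτ, hm'⟩ := hpoc'.exists_isMinPOC
  have hsub : SubOrder H' H := ⟨ν ≫ τ, hν.comp hτ⟩
  refine ⟨H', ⟨L', R', π ≫ c, γ', hinst, S, μ', g, m', hμ, hgt, hgi, hmin,
    hk.of_subOrder hsub, ?_⟩, hsub⟩
  refine happ.of_isSubgraphMor (hν.comp hτ) ?_
  rw [← Category.assoc, ← hK.w, Category.assoc, hm']

/-- Lets `μ` factor through `d` when it is undefined wherever `d` is; the second factor is the
subgraph morphism used for the shorter instantiation. -/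
theorem comp_invMor_comp {R₁ R' S : HGraph.{v, u} ar} {d : R₁ ⟶ R'} (hd : IsInj d) {μ : R₁ ⟶ S}
    (hV : ∀ y, nodeMap d y = none → nodeMap μ y = none)
    (hE : ∀ e, edgeMap d e = none → edgeMap μ e = none) : d ≫ invMor d hd ≫ μ = μ := by
  apply hom_ext
  · intro y
    cases h : nodeMap d y with
    | none => rw [hV y h, nodeMap_comp, h, Option.bind_none]
    | some z =>
      rw [nodeMap_comp, h, Option.bind_some, nodeMap_comp, (nodeMap_invMor hd).2 h,
        Option.bind_some]
  · intro y
    cases h : edgeMap d y with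
    | none => rw [hE y h, edgeMap_comp, h, Option.bind_none]
    | some z =>
      rw [edgeMap_comp, h, Option.bind_some, edgeMap_comp, (edgeMap_invMor hd).2 h,
        Option.bind_some]

theorem exists_shorter {ρ : UQRule.{v, u} ar} (hρ : NewEdgesAtNewNodes ρ) {k : ℕ∞} {n : ℕ}
    {G H : HGraph.{v, u} ar} (hH : H ∈ backward ρ k n G) (hn : Nat.card G.V < n) :
    ∃ n' < n, ∃ H' ∈ backward ρ k n' G, SubOrder H' H := by
  obtain ⟨L₁, R₁, π, γ, hinst, S, μ, g, m, hμ, hgt, hgi, hmin, hk, happ⟩ := hH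
  obtain ⟨ι, -, -, idx, hred⟩ := hinst.hasReduction hρ
  obtain ⟨s, hs, hfree⟩ : ∃ s < n, ∀ y, idx y = s → nodeMap μ y = none := by
    -- Otherwise each of the `n` steps has a surviving node. Nodes with different numbers are
    -- different, so their images under the injective `μ ≫ g` are `n` distinct nodes of `G`.
    by_contra! hcon
    have hex : ∀ s : Fin n, ∃ (x : G.V) (y : R₁.V), idx y = s ∧ nodeMap (μ ≫ g) y = some x := by
      intro s
      obtain ⟨y, hy, hne⟩ := hcon s s.2
      obtain ⟨z, hz⟩ := Option.ne_none_iff_exists'.1 hne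
      obtain ⟨x, hx⟩ := hgt.1 z
      exact ⟨x, y, hy, by rw [nodeMap_comp, hz, Option.bind_some, hx]⟩
    choose x y hy hx using hex
    have := G.finV
    have hinj : Function.Injective x := by
      intro a b hab
      have h1 := (hμ.1.comp hgi).1 _ _ _ (hx a) ((hx b).trans (congrArg some hab.symm))
      exact Fin.ext (by rw [← hy a, ← hy b, h1])
    have := Nat.card_le_card_of_injective x hinj
    rw [Nat.card_fin] at this
    omega
  obtain ⟨n', hn', L', R', -, γ', c, d, hinst', hc, hd, rfl, hcd, -, hnode, hedge⟩ := hred s hs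
  have hV : ∀ y, nodeMap d y = none → nodeMap μ y = none := fun y hy => hfree y (hnode y hy)
  have hμd : d ≫ invMor d hd.1 ≫ μ = μ := by
    -- An edge forgotten by `d` has a forgotten node, where `μ` is undefined; so `μ` is undefined on
    -- the edge too.
    refine comp_invMor_comp hd.1 hV fun e he => ?_
    obtain ⟨y, hinc, hy⟩ := hedge e he
    cases h : edgeMap μ e with
    | none => rfl
    | some z =>
      obtain ⟨y', hy', -⟩ := exists_incident_image μ h hinc
      rw [hV y hy] at hy'
      cases hy'
  have hμ' : IsSubgraphMor (invMor d hd.1 ≫ μ) :=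
    ⟨hd.1.invMor.comp hμ.1, IsSurj.of_comp (f := d) (by rw [hμd]; exact hμ.2)⟩
  exact ⟨n', hn', exists_mem_backward_of_factors hinst' hc hcd hμ' hgt hgi
    (by rw [hμd]; exact hmin.1) hk happ⟩

theorem isInstBound_card {ρ : UQRule.{v, u} ar} (hρ : NewEdgesAtNewNodes ρ) (G : HGraph.{v, u} ar)
    (k : ℕ∞) : IsInstBound ρ k G (Nat.card G.V) := by
  intro n
  induction n using Nat.strong_induction_on with
  | _ n ih =>
    intro H hH
    by_cases hn : n ≤ Nat.card G.V
    · exact ⟨n, hn, H, hH, SubOrder.refl H⟩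
    · obtain ⟨n₁, hn₁, H₁, hH₁, hsub₁⟩ := exists_shorter hρ hH (not_le.1 hn)
      obtain ⟨n₂, hn₂, H₂, hH₂, hsub₂⟩ := ih n₁ hn₁ H₁ hH₁
      exact ⟨n₂, hn₂, H₂, hH₂, hsub₂.trans hsub₁⟩

end InstantiationBound

end UGTS

theorem mainTheorem7 {Λ : Type*} [Finite Λ] (ar : Λ → ℕ) (ρ : UGTS.UQRule ar)
    (hρ : UGTS.NewEdgesAtNewNodes ρ) (G : UGTS.HGraph ar) (k : ℕ∞) :
    UGTS.IsInstBound ρ k G (Nat.card G.V) := by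
  exact UGTS.isInstBound_card hρ G k
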